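/- Let $A,B,X\in M_n(\mathbb{C})$ with $A$ and $B$ positive definite, and let $f:(0,\infty)\to\mathbb{R}$ be operator monotone, i.e. for every $m$ and all positive definite $S,T\in M_m(\mathbb{C})$ with $S\le T$ (that is, $T-S$ positive semidefinite) one has $f(S)\le f(T)$. Then $f$ is differentiable on $(0,\infty)$, and for every unitarily invariant norm $|||\cdot|||$ on $M_n(\mathbb{C})$ (a norm with $|||UYV|||=|||Y|||$ for all $Y\in M_n(\mathbb{C})$ and all unitary $U,V\in M_n(\mathbb{C})$), $$|||f(A)X-Xf(B)|||\le \max\{\|f'(A)\|,\|f'(B)\|\}\;|||AX-XB|||,$$ where $f(A),f(B),f'(A),f'(B)$ are defined by the functional calculus for Hermitian matrices and $\|\cdot\|$ is the operator (spectral) norm. -/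

import Mathlib

open scoped Matrix ComplexOrder

noncomputable section

/-- A norm on `M_n(ℂ)` (a definite seminorm) is unitarily invariant if `|||U A V||| = |||A|||`
for every matrix `A` and all unitary matrices `U`, `V`. -/
structure IsUnitarilyInvariantNorm {n : ℕ}
    (N : Seminorm ℂ (Matrix (Fin n) (Fin n) ℂ)) : Prop where
  definite : ∀ A : Matrix (Fin n) (Fin n) ℂ, N A = 0 → A = 0
  unitary_invariant : ∀ U ∈ Matrix.unitaryGroup (Fin n) ℂ, ∀ V ∈ Matrix.unitaryGroup (Fin n) ℂ,
    ∀ A : Matrix (Fin n) (Fin n) ℂ, N (U * A * V) = N A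

/-- A real function `f` is operator monotone on `(0, ∞)` if, for matrices of every size,
`A ≤ B` implies `f(A) ≤ f(B)` whenever `A` and `B` are Hermitian with spectra in `(0, ∞)`, that is,
positive definite. Here `A ≤ B` means that `B - A` is positive semidefinite, and `f(A)` is given by
the functional calculus, which uses only the values of `f` on the eigenvalues of `A`
(every function is continuous on that finite set). -/
def OperatorMonotoneOnPos (f : ℝ → ℝ) : Prop :=
  ∀ (m : ℕ) (A B : Matrix (Fin m) (Fin m) ℂ), A.PosDef → B.PosDef →
    (B - A).PosSemidef → (cfc f B - cfc f A).PosSemidef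

/-- The operator (spectral) norm of a matrix, acting on `ℂⁿ` with the Euclidean norm. -/
def matrixOpNorm {n : ℕ} (A : Matrix (Fin n) (Fin n) ℂ) : ℝ :=
  ‖Matrix.toEuclideanCLM (n := Fin n) (𝕜 := ℂ) A‖

end

/-!
The proof uses Loewner matrices instead of the integral representation of operator monotone
functions.

*Loewner matrices.* Comparing `2 × 2` matrices shows that `f` is concave
(`OperatorMonotoneOnPos.concaveOn`). For distinct points `xᵢ > 0` consider `f(A + εJ) - f(A) ≥ 0`,
where `A = diag(x)` and `J` is the all-ones matrix, and divide by `ε`. As `A + εJ` commutes with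
`f(A + εJ)`, the off-diagonal entries converge to the divided differences of `f`; by concavity the
diagonal ones are at most `(f(xᵢ + ε) - f(xᵢ)) / ε`. So the Loewner matrix with right derivatives on
the diagonal is positive semidefinite (`OperatorMonotoneOnPos.posSemidef_loewnerMatrix`). The
`2 × 2` case at `t ± s` excludes a kink at `t`, and so `f` is differentiable
(`OperatorMonotoneOnPos.hasDerivAt`).

*Schur multipliers.* If `A` and `B` are diagonalized with eigenvalues `aᵢ` and `bⱼ`, then
`f(A)X - Xf(B)` arises from `AX - XB` by entrywise multiplication with the divided differences of
`f` at `(aᵢ, bⱼ)`. They form an off-diagonal block of the Loewner matrix at the points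
`a₁, …, aₙ, b₁, …, bₙ`, whose diagonal entries `f'(aᵢ)`, `f'(bⱼ)` are at most
`max (‖f'(A)‖, ‖f'(B)‖)`. Multiplication by an off-diagonal block of a positive semidefinite matrix
with diagonal at most `M` increases a unitarily invariant norm at most by the factor `M`
(`IsUnitarilyInvariantNorm.apply_schur_le`); this is proved by duality, singular value
decompositions and Birkhoff's theorem on doubly stochastic matrices.
-/

/-! ### Functional calculus of diagonalized matrices -/

theorem Matrix.IsHermitian.exists_diagonalization {ι : Type*} [Fintype ι] [DecidableEq ι]
    {A : Matrix ι ι ℂ} (hA : A.IsHermitian) :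
    ∃ U ∈ Matrix.unitaryGroup ι ℂ,
      A = U * Matrix.diagonal (fun i => (hA.eigenvalues i : ℂ)) * Uᴴ ∧
      ∀ f : ℝ → ℝ, cfc f A = U * Matrix.diagonal (fun i => (f (hA.eigenvalues i) : ℂ)) * Uᴴ := by
  refine ⟨hA.eigenvectorUnitary, hA.eigenvectorUnitary.2, ?_, fun f => ?_⟩
  · conv_lhs => rw [hA.spectral_theorem]
    rfl
  · rw [hA.cfc_eq f]
    rfl

/-- The functional calculus may be computed in any unitary diagonalization: the unitary that
intertwines two diagonalizations only connects equal eigenvalues, hence also intertwines the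
diagonal matrices of the values of `f`. -/
theorem cfc_unitary_mul_diagonal {ι : Type*} [Fintype ι] [DecidableEq ι]
    {U : Matrix ι ι ℂ} (hU : U ∈ Matrix.unitaryGroup ι ℂ) (d : ι → ℝ) (f : ℝ → ℝ) :
    cfc f (U * Matrix.diagonal (fun i => (d i : ℂ)) * Uᴴ) =
      U * Matrix.diagonal (fun i => (f (d i) : ℂ)) * Uᴴ := by
  have hUU : Uᴴ * U = 1 := Matrix.mem_unitaryGroup_iff'.1 hU
  have hUU' : U * Uᴴ = 1 := Matrix.mem_unitaryGroup_iff.1 hU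
  have hH : (U * Matrix.diagonal (fun i => (d i : ℂ)) * Uᴴ).IsHermitian := by
    apply Matrix.isHermitian_mul_mul_conjTranspose
    simp [Matrix.IsHermitian, Matrix.diagonal_conjTranspose, Pi.star_def]
  obtain ⟨W, hW, h1, h2⟩ := hH.exists_diagonalization
  have hWW : Wᴴ * W = 1 := Matrix.mem_unitaryGroup_iff'.1 hW
  have hWW' : W * Wᴴ = 1 := Matrix.mem_unitaryGroup_iff.1 hW
  generalize hH.eigenvalues = l at h1 h2
  have h3 : Wᴴ * U * Matrix.diagonal (fun i => (d i : ℂ)) =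
      Matrix.diagonal (fun i => (l i : ℂ)) * (Wᴴ * U) := by
    have := congr(Wᴴ * $h1 * U)
    simp only [Matrix.mul_assoc, hUU, Matrix.mul_one] at this
    rw [← Matrix.mul_assoc Wᴴ W, hWW, Matrix.one_mul] at this
    simpa only [Matrix.mul_assoc] using this
  have h4 : Wᴴ * U * Matrix.diagonal (fun i => (f (d i) : ℂ)) =
      Matrix.diagonal (fun i => (f (l i) : ℂ)) * (Wᴴ * U) := by
    ext i j
    have := congr($h3 i j)
    rw [Matrix.mul_diagonal, Matrix.diagonal_mul] at this ⊢
    by_cases h0 : (Wᴴ * U) i j = 0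
    · simp [h0]
    · have h5 : (d j : ℂ) = l i := by
        apply mul_left_cancel₀ h0
        rw [this, mul_comm]
      rw [Complex.ofReal_inj.1 h5, mul_comm]
  rw [h2 f]
  have := congr(W * $h4 * Uᴴ)
  simp only [Matrix.mul_assoc, hUU', Matrix.mul_one] at this
  rw [← Matrix.mul_assoc W Wᴴ, hWW', Matrix.one_mul] at this
  simpa only [Matrix.mul_assoc] using this.symm

theorem cfc_diagonal_ofReal {ι : Type*} [Fintype ι] [DecidableEq ι] (d : ι → ℝ) (f : ℝ → ℝ) :
    cfc f (Matrix.diagonal (fun i => (d i : ℂ))) = Matrix.diagonal (fun i => (f (d i) : ℂ)) := by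
  simpa using cfc_unitary_mul_diagonal (one_mem (Matrix.unitaryGroup ι ℂ)) d f

theorem posDef_diagonal_ofReal {ι : Type*} [Fintype ι] [DecidableEq ι] {d : ι → ℝ}
    (hd : ∀ i, 0 < d i) : (Matrix.diagonal (fun i => (d i : ℂ))).PosDef :=
  Matrix.PosDef.diagonal fun i => by exact_mod_cast hd i

/-- For a Hermitian matrix the map sending `f` to the `i`-th diagonal entry of `f(A)` is
integration against a probability measure on the eigenvalues. -/
theorem Matrix.IsHermitian.exists_diag_cfc {ι : Type*} [Fintype ι] [DecidableEq ι]
    {A : Matrix ι ι ℂ} (hA : A.IsHermitian) (i : ι) :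
    ∃ w : ι → ℝ, (∀ k, 0 ≤ w k) ∧ ∑ k, w k = 1 ∧
      A i i = (∑ k, w k * hA.eigenvalues k : ℝ) ∧
      ∀ f : ℝ → ℝ, cfc f A i i = (∑ k, w k * f (hA.eigenvalues k) : ℝ) := by
  obtain ⟨U, hU, h1, h2⟩ := hA.exists_diagonalization
  have key : ∀ e : ι → ℝ, (U * Matrix.diagonal (fun i => (e i : ℂ)) * Uᴴ) i i =
      (∑ k, Complex.normSq (U i k) * e k : ℝ) := by
    intro e
    rw [Matrix.mul_apply]
    push_cast
    refine Finset.sum_congr rfl fun k _ => ?_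
    rw [Matrix.mul_diagonal, Matrix.conjTranspose_apply, Complex.normSq_eq_conj_mul_self,
      Complex.star_def]
    ring
  refine ⟨fun k => Complex.normSq (U i k), fun k => Complex.normSq_nonneg _, ?_, ?_, fun f => ?_⟩
  · have := key 1
    simp only [Pi.one_apply, Complex.ofReal_one, Matrix.diagonal_one, Matrix.mul_one] at this
    rw [show U * Uᴴ = 1 from Matrix.mem_unitaryGroup_iff.1 hU] at this
    simp only [Matrix.one_apply_eq, mul_one] at this
    exact_mod_cast this.symm
  · conv_lhs => rw [h1]
    exact key _
  · rw [h2 f]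
    exact key _

/-! ### Concavity of operator monotone functions -/

namespace OperatorMonotoneOnPos

variable {f : ℝ → ℝ}

/-- For `a, b > 0` the `2 × 2` matrix unitarily equivalent to `diag(a, b)` with diagonal
`θ a + (1 - θ) b, d` is dominated by `diag(θ a + (1 - θ) b + ε, d + c² / ε)`, where `c` is its
off-diagonal entry. Comparing the upper left entries of the values of `f` gives concavity up to
`ε`. -/
theorem le_apply_add (hf : OperatorMonotoneOnPos f) {a b θ ε : ℝ} (ha : 0 < a) (hb : 0 < b)
    (h0 : 0 ≤ θ) (h1 : θ ≤ 1) (hε : 0 < ε) :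
    θ * f a + (1 - θ) * f b ≤ f (θ * a + (1 - θ) * b + ε) := by
  obtain ⟨p, hp⟩ : ∃ p : ℝ, p ^ 2 = θ := ⟨√θ, Real.sq_sqrt h0⟩
  obtain ⟨q, hq⟩ : ∃ q : ℝ, q ^ 2 = 1 - θ := ⟨√(1 - θ), Real.sq_sqrt (by linarith)⟩
  set U : Matrix (Fin 2) (Fin 2) ℂ := !![(p : ℂ), q; -q, p] with hUdef
  have hUH : Uᴴ = !![(p : ℂ), -q; q, p] := by
    ext i j; fin_cases i <;> fin_cases j <;> simp [hUdef]
  have hpq : (p : ℂ) * p + q * q = 1 := by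
    norm_cast
    nlinarith
  have hU : U ∈ Matrix.unitaryGroup (Fin 2) ℂ := by
    rw [Matrix.mem_unitaryGroup_iff]
    change U * Uᴴ = 1
    rw [hUH, hUdef]
    ext i j; fin_cases i <;> fin_cases j <;> simp [Matrix.mul_apply, Fin.sum_univ_two] <;>
      first | linear_combination hpq | ring1
  have key : ∀ x : Fin 2 → ℝ, U * Matrix.diagonal (fun i => (x i : ℂ)) * Uᴴ =
      !![((θ * x 0 + (1 - θ) * x 1 : ℝ) : ℂ), ((p * q * (x 1 - x 0) : ℝ) : ℂ);
        ((p * q * (x 1 - x 0) : ℝ) : ℂ), ((q ^ 2 * x 0 + p ^ 2 * x 1 : ℝ) : ℂ)] := by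
    intro x
    rw [hUH, ← hp, show (1 - p ^ 2 : ℝ) = q ^ 2 by rw [hp, hq]]
    ext i j
    rw [Matrix.mul_apply, Fin.sum_univ_two, Matrix.mul_diagonal, Matrix.mul_diagonal, hUdef]
    fin_cases i <;> fin_cases j <;> simp <;> ring
  set d : ℝ := q ^ 2 * a + p ^ 2 * b with hd
  set c : ℝ := p * q * (b - a) with hc
  set m : ℝ := θ * a + (1 - θ) * b with hm
  have hd0 : 0 ≤ d := by positivity
  have hm0 : 0 ≤ m := by
    have : 0 ≤ 1 - θ := by linarith
    positivity
  set x : Fin 2 → ℝ := ![a, b] with hx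
  set y : Fin 2 → ℝ := ![m + ε, d + c ^ 2 / ε + 1] with hy
  have hx0 : ∀ i, 0 < x i := by
    intro i; fin_cases i <;> simpa [hx]
  have hy0 : ∀ i, 0 < y i := by
    intro i; fin_cases i <;> simp [hy] <;> positivity
  have hUu : IsUnit U := (Unitary.toUnits ⟨U, hU⟩).isUnit
  have hP1 : (U * Matrix.diagonal (fun i => (x i : ℂ)) * Uᴴ).PosDef :=
    (Matrix.IsUnit.posDef_star_right_conjugate_iff hUu).2 (posDef_diagonal_ofReal hx0)
  have hP2 := posDef_diagonal_ofReal hy0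
  have hdiff : (Matrix.diagonal (fun i => (y i : ℂ)) -
      U * Matrix.diagonal (fun i => (x i : ℂ)) * Uᴴ).PosSemidef := by
    have h3 : Matrix.diagonal (fun i => (y i : ℂ)) -
        U * Matrix.diagonal (fun i => (x i : ℂ)) * Uᴴ =
        !![(√ε : ℂ), 0; -(c / √ε : ℝ), 1] * (!![(√ε : ℂ), 0; -(c / √ε : ℝ), 1])ᴴ := by
      have he : (√ε : ℝ) ≠ 0 := (Real.sqrt_pos.2 hε).ne'
      have he2 : ε = √ε ^ 2 := (Real.sq_sqrt hε.le).symm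
      rw [key]
      ext i j; fin_cases i <;> fin_cases j <;>
        simp [Matrix.mul_apply, Fin.sum_univ_two, hx, hy, -Complex.ofReal_div] <;>
        norm_cast
      · rw [← hm, ← pow_two, ← he2]; ring
      · field_simp; rfl
      · field_simp; rfl
      · rw [← hd]
        conv_lhs => rw [he2]
        field_simp
        ring
    rw [h3]
    exact Matrix.posSemidef_self_mul_conjTranspose _
  have h4 := hf 2 _ _ hP1 hP2 hdiff
  rw [cfc_unitary_mul_diagonal hU, cfc_diagonal_ofReal, key (fun i => f (x i))] at h4
  have h5 := h4.diag_nonneg (i := 0)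
  simp only [Matrix.sub_apply, Matrix.diagonal_apply_eq, Matrix.of_apply, Matrix.cons_val_zero, hx,
    hy, Matrix.cons_val_one, Matrix.cons_val', Matrix.cons_val_fin_one] at h5
  rw [← Complex.ofReal_sub, Complex.zero_le_real] at h5
  linarith

theorem monotoneOn (hf : OperatorMonotoneOnPos f) : MonotoneOn f (Set.Ioi 0) := by
  intro a ha b hb hab
  rcases hab.eq_or_lt with rfl | hab
  · exact le_rfl
  · have := hf.le_apply_add ha ha zero_le_one le_rfl (sub_pos.2 hab)
    simpa using this

/-- Concavity follows from concavity up to `ε` because that inequality also forces `f` to be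
left-continuous. -/
theorem concaveOn (hf : OperatorMonotoneOnPos f) : ConcaveOn ℝ (Set.Ioi 0) f := by
  -- Near the upper end of `[b / 2, b]` the graph of `f` lies above a line through `(b, f b)`.
  have hleft : ∀ b > 0, ∀ δ > 0, δ ≤ b / 4 →
      f b - 4 * δ / b * (f b - f (b / 2)) ≤ f (b - δ) := by
    intro b hb δ hδ hδb
    have h := hf.le_apply_add (half_pos hb) hb (θ := 4 * δ / b) (by positivity)
      (by rw [div_le_one hb]; linarith) hδ
    have h2 : 4 * δ / b * (b / 2) + (1 - 4 * δ / b) * b + δ = b - δ := by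
      field_simp; ring
    rw [h2] at h
    linarith
  refine ⟨convex_Ioi 0, fun a ha b hb s t hs ht hst => ?_⟩
  have ha : 0 < a := ha
  have hb : 0 < b := hb
  obtain rfl : t = 1 - s := by linarith
  simp only [smul_eq_mul]
  set ga := 4 / a * (f a - f (a / 2))
  set gb := 4 / b * (f b - f (b / 2))
  have hev : ∀ᶠ δ in nhdsWithin (0 : ℝ) (Set.Ioi 0),
      s * (f a - δ * ga) + (1 - s) * (f b - δ * gb) ≤ f (s * a + (1 - s) * b) := by
    filter_upwards [Ioc_mem_nhdsGT (show 0 < min (a / 4) (b / 4) by positivity)] with δ hδ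
    have hδa := hδ.2.trans (min_le_left _ _)
    have hδb := hδ.2.trans (min_le_right _ _)
    have h := hf.le_apply_add (a := a - δ) (b := b - δ) (by linarith) (by linarith) hs
      (by linarith) hδ.1
    rw [show s * (a - δ) + (1 - s) * (b - δ) + δ = s * a + (1 - s) * b by ring] at h
    have h1 := hleft a ha δ hδ.1 hδa
    have h2 := hleft b hb δ hδ.1 hδb
    have h1' : f a - δ * ga ≤ f (a - δ) := by
      refine le_trans (le_of_eq ?_) h1
      simp only [ga]; ring
    have h2' : f b - δ * gb ≤ f (b - δ) := by
      refine le_trans (le_of_eq ?_) h2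
      simp only [gb]; ring
    have := mul_le_mul_of_nonneg_left h1' hs
    have := mul_le_mul_of_nonneg_left h2' ht
    linarith
  refine le_of_tendsto (f := fun δ : ℝ => s * (f a - δ * ga) + (1 - s) * (f b - δ * gb)) ?_ hev
  refine Filter.Tendsto.mono_left (Continuous.tendsto' (by fun_prop) _ _ (by simp)) nhdsWithin_le_nhds

end OperatorMonotoneOnPos

/-! ### Loewner matrices -/

/-- The Loewner matrix of `f` at the points `x i`, possibly with repetitions: its entries are the
divided differences of `f`, where `g (x i)` takes the place of the divided difference at
coinciding points. -/
noncomputable def loewnerMatrix {ι : Type*} (f g : ℝ → ℝ) (x : ι → ℝ) : Matrix ι ι ℂ :=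
  Matrix.of fun i j => ((if x i = x j then g (x i) else slope f (x i) (x j) : ℝ) : ℂ)

theorem loewnerMatrix_apply_self {ι : Type*} (f g : ℝ → ℝ) (x : ι → ℝ) (i : ι) :
    loewnerMatrix f g x i i = (g (x i) : ℂ) := by
  simp [loewnerMatrix]

theorem loewnerMatrix_apply_of_ne {ι : Type*} (f g : ℝ → ℝ) {x : ι → ℝ} {i j : ι}
    (h : x i ≠ x j) : loewnerMatrix f g x i j = (slope f (x i) (x j) : ℂ) := by
  simp [loewnerMatrix, h]

/-- The principal `2 × 2` minors of a positive semidefinite matrix are nonnegative. -/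
theorem norm_sq_apply_le_of_posSemidef {ι : Type*} [Fintype ι] [DecidableEq ι]
    {G : Matrix ι ι ℂ} (hG : G.PosSemidef) (i j : ι) :
    ‖G i j‖ ^ 2 ≤ (G i i).re * (G j j).re := by
  have h := (hG.submatrix ![i, j]).det_nonneg
  rw [Matrix.det_fin_two] at h
  simp only [Matrix.submatrix_apply, Matrix.cons_val_zero, Matrix.cons_val_one] at h
  have hji : G j i = star (G i j) := (hG.1.apply j i).symm
  have hre : ∀ k, G k k = ((G k k).re : ℂ) := fun k =>
    Complex.ext rfl (by simpa using (Complex.nonneg_iff.1 (hG.diag_nonneg (i := k))).2.symm)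
  rw [hji, hre i, hre j, Complex.star_def, Complex.mul_conj, Complex.normSq_eq_norm_sq] at h
  norm_cast at h
  linarith

/-- Jensen's inequality for diagonal entries. -/
theorem ConcaveOn.re_cfc_apply_self_le {ι : Type*} [Fintype ι] [DecidableEq ι] {f : ℝ → ℝ}
    (hf : ConcaveOn ℝ (Set.Ioi 0) f) {A : Matrix ι ι ℂ} (hA : A.PosDef) (i : ι) :
    (cfc f A i i).re ≤ f (A i i).re := by
  obtain ⟨w, hw0, hw1, h1, h2⟩ := hA.1.exists_diag_cfc i
  rw [h1, h2, Complex.ofReal_re, Complex.ofReal_re]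
  simpa using hf.le_map_sum (t := Finset.univ) (w := w) (p := hA.1.eigenvalues)
    (fun k _ => hw0 k) hw1 (fun k _ => hA.eigenvalues_pos k)

namespace OperatorMonotoneOnPos

variable {f : ℝ → ℝ}

/-- Loewner's theorem for pairwise distinct points, with right derivatives on the diagonal.

Let `A = diag(x)`, let `J` be the all-ones matrix and `G(ε) = f(A + εJ) - f(A)`, which is positive
semidefinite. By concavity `G(ε)ᵢᵢ ≤ f(xᵢ + ε) - f(xᵢ)`, so `G(ε)` tends to zero with `ε`. As
`A + εJ` commutes with `f(A) + G(ε)`, the off-diagonal entries of `G(ε) / ε` equal the divided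
differences of `f` up to an error linear in `G(ε)`. Hence the Loewner matrix is a limit of positive
semidefinite matrices. -/
theorem posSemidef_loewnerMatrix_of_injective (hf : OperatorMonotoneOnPos f) {m : ℕ}
    {x : Fin m → ℝ} (hx : ∀ i, 0 < x i) (hinj : Function.Injective x) {g : ℝ → ℝ}
    (hg : ∀ i, HasDerivWithinAt f (g (x i)) (Set.Ioi (x i)) (x i)) :
    (loewnerMatrix f g x).PosSemidef := by
  set A : Matrix (Fin m) (Fin m) ℂ := Matrix.diagonal fun i => (x i : ℂ) with hA
  set J : Matrix (Fin m) (Fin m) ℂ := Matrix.of fun _ _ => 1 with hJ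
  have hJpos : J.PosSemidef := by
    convert Matrix.posSemidef_vecMulVec_self_star (fun _ : Fin m => (1 : ℂ)) using 1
    ext i j
    simp [hJ, Matrix.vecMulVec_apply]
  have hApos : A.PosDef := posDef_diagonal_ofReal hx
  set G : ℝ → Matrix (Fin m) (Fin m) ℂ := fun ε => cfc f (A + (ε : ℂ) • J) - cfc f A with hG
  have hBpos : ∀ ε : ℝ, 0 < ε → (A + (ε : ℂ) • J).PosDef := fun ε hε =>
    hApos.add_posSemidef (hJpos.smul (by exact_mod_cast hε.le))
  have hGpos : ∀ ε : ℝ, 0 < ε → (G ε).PosSemidef := fun ε hε => by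
    refine hf m _ _ hApos (hBpos ε hε) ?_
    rw [add_sub_cancel_left]
    exact hJpos.smul (by exact_mod_cast hε.le)
  have hcA : cfc f A = Matrix.diagonal fun i => (f (x i) : ℂ) := cfc_diagonal_ofReal x f
  have hdiag : ∀ ε : ℝ, 0 < ε → ∀ i, (G ε i i).re ≤ f (x i + ε) - f (x i) := fun ε hε i => by
    have h := hf.concaveOn.re_cfc_apply_self_le (hBpos ε hε) i
    simp only [hG, hcA, Matrix.sub_apply, Matrix.diagonal_apply_eq, Complex.sub_re,
      Complex.ofReal_re]
    simpa [hA, hJ] using h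
  have hdiag0 : ∀ ε : ℝ, 0 < ε → ∀ i, 0 ≤ (G ε i i).re := fun ε hε i =>
    (Complex.nonneg_iff.1 ((hGpos ε hε).diag_nonneg (i := i))).1
  have hpos : ∀ᶠ ε : ℝ in nhdsWithin 0 (Set.Ioi 0), 0 < ε := self_mem_nhdsWithin
  have hshift : ∀ i, Filter.Tendsto (fun ε : ℝ => x i + ε) (nhdsWithin 0 (Set.Ioi 0))
      (nhdsWithin (x i) (Set.Ioi (x i))) := fun i => by
    refine tendsto_nhdsWithin_iff.2 ⟨?_, hpos.mono fun ε hε => by simpa using hε⟩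
    exact (Continuous.tendsto' (by fun_prop) _ _ (by simp)).mono_left nhdsWithin_le_nhds
  have hincr : ∀ i, Filter.Tendsto (fun ε : ℝ => f (x i + ε) - f (x i))
      (nhdsWithin 0 (Set.Ioi 0)) (nhds 0) := fun i => by
    have h := ((hg i).continuousWithinAt.tendsto.comp (hshift i)).sub_const (f (x i))
    simpa using h
  have hslope : ∀ i, Filter.Tendsto (fun ε : ℝ => (f (x i + ε) - f (x i)) / ε)
      (nhdsWithin 0 (Set.Ioi 0)) (nhds (g (x i))) := fun i => by
    have h := ((hasDerivWithinAt_iff_tendsto_slope' (by simp)).1 (hg i)).comp (hshift i)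
    refine h.congr fun ε => ?_
    simp [slope_def_field]
  have hGlim : ∀ i j, Filter.Tendsto (fun ε => G ε i j) (nhdsWithin 0 (Set.Ioi 0)) (nhds 0) := by
    intro i j
    rw [tendsto_zero_iff_norm_tendsto_zero]
    have h := ((hincr i).mul (hincr j)).sqrt
    rw [mul_zero, Real.sqrt_zero] at h
    refine squeeze_zero' (Filter.Eventually.of_forall fun _ => norm_nonneg _)
      (hpos.mono fun ε hε => ?_) h
    refine Real.le_sqrt_of_sq_le ((norm_sq_apply_le_of_posSemidef (hGpos ε hε) i j).trans ?_)
    exact mul_le_mul (hdiag ε hε i) (hdiag ε hε j) (hdiag0 ε hε j)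
      ((hdiag0 ε hε i).trans (hdiag ε hε i))
  have hcomm : ∀ ε : ℝ, ∀ i j, i ≠ j → ((x i : ℂ) - x j) * G ε i j =
      ε * (f (x i) - f (x j) + ∑ k, (G ε i k - G ε k j)) := by
    intro ε i j hij
    have hc : Commute (cfc f (A + (ε : ℂ) • J)) (A + (ε : ℂ) • J) := by
      by_cases hH : IsSelfAdjoint (A + (ε : ℂ) • J)
      · simpa only [cfc_id ℝ _ hH] using cfc_commute_cfc f id (A + (ε : ℂ) • J)
      · rw [cfc_apply_of_not_predicate _ hH]
        exact Commute.zero_left _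
    have hF : cfc f (A + (ε : ℂ) • J) = Matrix.diagonal (fun i => (f (x i) : ℂ)) + G ε := by
      rw [hG, hcA]
      exact (add_sub_cancel _ _).symm
    have h := congr($(hc.eq) i j)
    rw [hF, add_mul, add_mul, mul_add, mul_add, mul_add, mul_add] at h
    simp only [hA, Matrix.add_apply, Matrix.diagonal_mul, Matrix.mul_diagonal, Matrix.smul_apply,
      Matrix.mul_smul, Matrix.smul_mul, Matrix.diagonal_apply_ne _ hij] at h
    have h1 : (G ε * J) i j = ∑ k, G ε i k := by simp [hJ, Matrix.mul_apply]
    have h2 : (J * G ε) i j = ∑ k, G ε k j := by simp [hJ, Matrix.mul_apply]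
    rw [h1, h2] at h
    simp only [hJ, Matrix.of_apply, smul_eq_mul] at h
    rw [Finset.sum_sub_distrib]
    linear_combination -h
  set H : ℝ → Matrix (Fin m) (Fin m) ℂ := fun ε => Matrix.of fun i j =>
    if i = j then (((f (x i + ε) - f (x i)) / ε : ℝ) : ℂ) else G ε i j / ε with hH
  have hHpos : ∀ ε : ℝ, 0 < ε → (H ε).PosSemidef := by
    intro ε hε
    have h : H ε = ((1 / ε : ℝ) : ℂ) • G ε + Matrix.diagonal
        (fun i => (((f (x i + ε) - f (x i) - (G ε i i).re) / ε : ℝ) : ℂ)) := by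
      ext i j
      by_cases hij : i = j
      · subst hij
        have hre : G ε i i = ((G ε i i).re : ℂ) :=
          Complex.ext rfl
            (by simpa using (Complex.nonneg_iff.1 ((hGpos ε hε).diag_nonneg (i := i))).2.symm)
        simp only [hH, Matrix.of_apply, if_true, Matrix.add_apply, Matrix.smul_apply,
          Matrix.diagonal_apply_eq, smul_eq_mul]
        rw [hre]
        simp only [Complex.ofReal_re]
        norm_cast
        ring
      · simp [hH, hij, div_eq_inv_mul]
    rw [h]
    refine ((hGpos ε hε).smul (by exact_mod_cast (by positivity : 0 ≤ 1 / ε))).add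
      (Matrix.PosSemidef.diagonal fun i => ?_)
    simp only [Pi.zero_apply]
    exact_mod_cast div_nonneg (sub_nonneg.2 (hdiag ε hε i)) hε.le
  have hHlim : Filter.Tendsto H (nhdsWithin 0 (Set.Ioi 0)) (nhds (loewnerMatrix f g x)) := by
    refine tendsto_pi_nhds.2 fun i => tendsto_pi_nhds.2 fun j => ?_
    by_cases hij : i = j
    · subst hij
      simp only [hH, loewnerMatrix, Matrix.of_apply, if_true]
      exact (Complex.continuous_ofReal.tendsto _).comp (hslope i)
    · have hne : x i ≠ x j := fun h => hij (hinj h)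
      have hne' : ((x i : ℂ) - x j) ≠ 0 := sub_ne_zero.2 (by exact_mod_cast hne)
      have hlim : Filter.Tendsto
          (fun ε => ((f (x i) : ℂ) - f (x j) + ∑ k, (G ε i k - G ε k j)) / ((x i : ℂ) - x j))
          (nhdsWithin 0 (Set.Ioi 0)) (nhds (loewnerMatrix f g x i j)) := by
        have h := (((tendsto_finsetSum (Finset.univ : Finset (Fin m)) fun k _ =>
          (hGlim i k).sub (hGlim k j)).const_add ((f (x i) : ℂ) - f (x j))).div_const
            ((x i : ℂ) - x j))
        convert h using 2
        simp only [loewnerMatrix, Matrix.of_apply, if_neg hne, slope_def_field]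
        push_cast
        rw [← neg_sub (f (x i) : ℂ), ← neg_sub (x i : ℂ), neg_div_neg_eq]
        simp
      refine hlim.congr' (hpos.mono fun ε hε => ?_)
      have hε' : (ε : ℂ) ≠ 0 := by exact_mod_cast hε.ne'
      simp only [hH, Matrix.of_apply, if_neg hij]
      rw [div_eq_div_iff hne' hε']
      linear_combination -hcomm ε i j hij
  refine Matrix.PosSemidef.of_dotProduct_mulVec_nonneg ?_ fun c => ?_
  · ext i j
    simp only [Matrix.conjTranspose_apply, loewnerMatrix, Matrix.of_apply, Complex.star_def,
      Complex.conj_ofReal]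
    by_cases hij : x i = x j
    · simp [hij]
    · simp [hij, Ne.symm hij, slope_comm]
  · have hcont : Continuous fun M : Matrix (Fin m) (Fin m) ℂ => star c ⬝ᵥ M *ᵥ c := by fun_prop
    exact ge_of_tendsto ((hcont.tendsto _).comp hHlim)
      (hpos.mono fun ε hε => (hHpos ε hε).dotProduct_mulVec_nonneg c)

/-- Loewner's theorem, with right derivatives on the diagonal; repeated points are reduced to
distinct ones by passing to a submatrix. -/
theorem posSemidef_loewnerMatrix (hf : OperatorMonotoneOnPos f) {ι : Type*} [Finite ι]
    {x : ι → ℝ} (hx : ∀ i, 0 < x i) {g : ℝ → ℝ}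
    (hg : ∀ t > 0, HasDerivWithinAt f (g t) (Set.Ioi t) t) :
    (loewnerMatrix f g x).PosSemidef := by
  obtain ⟨m, ⟨e⟩⟩ := Finite.exists_equiv_fin (Set.range x)
  have hy : ∀ k, 0 < ((e.symm k : Set.range x) : ℝ) := fun k => by
    obtain ⟨i, hi⟩ := (e.symm k).2
    exact hi ▸ hx i
  have h := hf.posSemidef_loewnerMatrix_of_injective (x := fun k => (e.symm k : ℝ)) hy
    (Subtype.val_injective.comp e.symm.injective) (g := g) fun k => hg _ (hy k)
  convert h.submatrix fun i => e ⟨x i, i, rfl⟩ using 1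
  ext i j
  simp [loewnerMatrix]

/-! ### Differentiability of operator monotone functions -/

theorem hasDerivWithinAt_Ioi (hf : OperatorMonotoneOnPos f) {t : ℝ} (ht : 0 < t) :
    HasDerivWithinAt f (derivWithin f (Set.Ioi t) t) (Set.Ioi t) t := by
  have h := hf.concaveOn.neg.differentiableWithinAt_Ioi_of_mem_interior (x := t)
    (by rwa [interior_Ioi])
  have h2 := h.neg
  rw [neg_neg] at h2
  exact h2.hasDerivWithinAt

theorem hasDerivWithinAt_Iio (hf : OperatorMonotoneOnPos f) {t : ℝ} (ht : 0 < t) :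
    HasDerivWithinAt f (derivWithin f (Set.Iio t) t) (Set.Iio t) t := by
  have h := hf.concaveOn.neg.differentiableWithinAt_Iio_of_mem_interior (x := t)
    (by rwa [interior_Ioi])
  have h2 := h.neg
  rw [neg_neg] at h2
  exact h2.hasDerivWithinAt

/-- Let `p` and `q` be the left and right derivatives at `t`. The `2 × 2` Loewner matrices at
`t - s, t + s` yield `((p + q) / 2)² ≤ p q` in the limit `s → 0`, whence `p = q`. -/
theorem hasDerivAt (hf : OperatorMonotoneOnPos f) {t : ℝ} (ht : 0 < t) :
    HasDerivAt f (derivWithin f (Set.Ioi t) t) t := by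
  set q := derivWithin f (Set.Ioi t) t with hq
  set p := derivWithin f (Set.Iio t) t with hp
  have hQ := hf.hasDerivWithinAt_Ioi ht
  have hP := hf.hasDerivWithinAt_Iio ht
  set g : ℝ → ℝ := fun t => derivWithin f (Set.Ioi t) t with hg
  have hpos : ∀ᶠ s : ℝ in nhdsWithin 0 (Set.Ioi 0), 0 < s := self_mem_nhdsWithin
  have hlimQ : Filter.Tendsto (fun s : ℝ => (f (t + s) - f t) / s) (nhdsWithin 0 (Set.Ioi 0))
      (nhds q) := by
    have hs : Filter.Tendsto (fun s : ℝ => t + s) (nhdsWithin 0 (Set.Ioi 0))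
        (nhdsWithin t (Set.Ioi t)) := by
      refine tendsto_nhdsWithin_iff.2 ⟨?_, hpos.mono fun ε hε => by simpa using hε⟩
      exact (Continuous.tendsto' (by fun_prop) _ _ (by simp)).mono_left nhdsWithin_le_nhds
    refine (((hasDerivWithinAt_iff_tendsto_slope' (by simp)).1 hQ).comp hs).congr fun s => ?_
    simp [slope_def_field]
  have hlimP : Filter.Tendsto (fun s : ℝ => (f t - f (t - s)) / s) (nhdsWithin 0 (Set.Ioi 0))
      (nhds p) := by
    have hs : Filter.Tendsto (fun s : ℝ => t - s) (nhdsWithin 0 (Set.Ioi 0))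
        (nhdsWithin t (Set.Iio t)) := by
      refine tendsto_nhdsWithin_iff.2 ⟨?_, hpos.mono fun ε hε => by simpa using hε⟩
      exact (Continuous.tendsto' (by fun_prop) _ _ (by simp)).mono_left nhdsWithin_le_nhds
    refine (((hasDerivWithinAt_iff_tendsto_slope' (by simp)).1 hP).comp hs).congr fun s => ?_
    simp only [Function.comp_apply, slope_def_field]
    rw [show t - s - t = -s by ring, ← neg_sub (f t), neg_div_neg_eq]
  -- The right derivative at `t - s` is at most the slope of `f` on `[t - 2s, t - s]`.
  have hlimP' : Filter.Tendsto (fun s : ℝ => (f (t - s) - f (t - 2 * s)) / s)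
      (nhdsWithin 0 (Set.Ioi 0)) (nhds p) := by
    have h2 : Filter.Tendsto (fun s : ℝ => 2 * s) (nhdsWithin 0 (Set.Ioi 0))
        (nhdsWithin 0 (Set.Ioi 0)) := by
      refine tendsto_nhdsWithin_iff.2 ⟨?_, hpos.mono fun ε hε => by simpa using hε⟩
      exact (Continuous.tendsto' (by fun_prop) _ _ (by simp)).mono_left nhdsWithin_le_nhds
    have h := ((hlimP.comp h2).const_mul 2).sub hlimP
    rw [show 2 * p - p = p by ring] at h
    refine h.congr' (hpos.mono fun s hs => ?_)
    have : s ≠ 0 := hs.ne'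
    simp only [Function.comp_apply]
    field_simp
    ring
  have hineq : ∀ᶠ s : ℝ in nhdsWithin 0 (Set.Ioi 0),
      (((f (t + s) - f t) / s + (f t - f (t - s)) / s) / 2) ^ 2 ≤
        (f (t - s) - f (t - 2 * s)) / s * ((f (t + s) - f t) / s) := by
    filter_upwards [Ioo_mem_nhdsGT (show 0 < t / 2 by positivity)] with s hs
    have hs0 : 0 < s := hs.1
    have hst : s < t / 2 := hs.2
    have ha : 0 < t - s := by linarith
    have hb : 0 < t + s := by linarith
    have hL := hf.posSemidef_loewnerMatrix (x := ![t - s, t + s]) (g := g)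
      (by intro i; fin_cases i <;> simp <;> linarith)
      (fun u hu => hf.hasDerivWithinAt_Ioi hu)
    have hne : t - s ≠ t + s := by linarith
    have h := norm_sq_apply_le_of_posSemidef hL 0 1
    have h0 := hL.diag_nonneg (i := 0)
    have h1 := hL.diag_nonneg (i := 1)
    rw [loewnerMatrix_apply_of_ne f g (x := ![t - s, t + s]) (i := 0) (j := 1) hne] at h
    simp only [loewnerMatrix_apply_self, Matrix.cons_val_zero, Matrix.cons_val_one,
      Complex.ofReal_re, Complex.norm_real, Real.norm_eq_abs, sq_abs,
      Complex.zero_le_real] at h h0 h1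
    have hga : g (t - s) ≤ (f (t - s) - f (t - 2 * s)) / s := by
      -- Concavity: the slope just left of `t - s` bounds the slopes to its right.
      refine le_of_tendsto ((hasDerivWithinAt_iff_tendsto_slope' (by simp)).1
        (hf.hasDerivWithinAt_Ioi ha)) ?_
      filter_upwards [self_mem_nhdsWithin] with u hu
      have h := hf.concaveOn.slope_anti_adjacent (x := t - 2 * s) (y := t - s) (z := u)
        (by simp; linarith) (by simp only [Set.mem_Ioi] at hu ⊢; linarith) (by linarith) hu
      rw [slope_def_field]
      refine h.trans_eq ?_
      congr 1
      ring
    have hgb : g (t + s) ≤ (f (t + s) - f t) / s := by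
      refine le_of_tendsto ((hasDerivWithinAt_iff_tendsto_slope' (by simp)).1
        (hf.hasDerivWithinAt_Ioi hb)) ?_
      filter_upwards [self_mem_nhdsWithin] with u hu
      have h := hf.concaveOn.slope_anti_adjacent (x := t) (y := t + s) (z := u)
        ht (by simp only [Set.mem_Ioi] at hu ⊢; linarith) (by linarith) hu
      rw [slope_def_field]
      refine h.trans_eq ?_
      congr 1
      ring
    have hmul := mul_le_mul hga hgb h1 (h0.trans hga)
    refine le_trans (le_of_eq ?_) (h.trans hmul)
    rw [slope_def_field]
    congr 1
    field_simp
    ring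
  have hfinal := le_of_tendsto_of_tendsto (((hlimQ.add hlimP).div_const 2).pow 2)
    (hlimP'.mul hlimQ) hineq
  have hpq : p = q := by
    have : (p - q) ^ 2 ≤ 0 := by nlinarith
    have := pow_eq_zero_iff (two_ne_zero) |>.1 (le_antisymm this (sq_nonneg _))
    linarith
  rw [← hp, hpq] at hP
  have h := hP.union hQ.Ici_of_Ioi
  rwa [Set.Iio_union_Ici, hasDerivWithinAt_univ] at h

end OperatorMonotoneOnPos

/-! ### Singular value decomposition -/

/-- If `V` diagonalizes `Yᴴ Y`, then the columns of `Y V` are orthogonal with norms the singular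
values; the normalized nonzero columns extend to an orthonormal basis. -/
theorem Matrix.exists_singularValueDecomposition {ι : Type*} [Fintype ι] [DecidableEq ι]
    (Y : Matrix ι ι ℂ) :
    ∃ U ∈ Matrix.unitaryGroup ι ℂ, ∃ V ∈ Matrix.unitaryGroup ι ℂ, ∃ s : ι → ℝ,
      (∀ i, 0 ≤ s i) ∧ Y = U * Matrix.diagonal (fun i => (s i : ℂ)) * Vᴴ := by
  have hH := Matrix.posSemidef_conjTranspose_mul_self Y
  obtain ⟨V, hV, hYV, -⟩ := hH.1.exists_diagonalization
  have hl := hH.eigenvalues_nonneg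
  generalize hH.1.eigenvalues = l at hYV hl
  have hVV : Vᴴ * V = 1 := Matrix.mem_unitaryGroup_iff'.1 hV
  have hVV' : V * Vᴴ = 1 := Matrix.mem_unitaryGroup_iff.1 hV
  have hW : (Y * V)ᴴ * (Y * V) = Matrix.diagonal (fun i => (l i : ℂ)) := by
    have := congr(Vᴴ * $hYV * V)
    simp only [Matrix.mul_assoc, hVV, Matrix.mul_one] at this
    rw [← Matrix.mul_assoc Vᴴ V, hVV, Matrix.one_mul] at this
    rw [Matrix.conjTranspose_mul, Matrix.mul_assoc, this]
  set W := Y * V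
  have hinner : ∀ i j, ∑ k, star (W k i) * W k j = if i = j then (l i : ℂ) else 0 := by
    intro i j
    have := congr($hW i j)
    rwa [Matrix.mul_apply, Matrix.diagonal_apply] at this
  set v : ι → EuclideanSpace ℂ ι := fun j => WithLp.toLp 2 fun k => ((√(l j) : ℂ))⁻¹ * W k j
  have hv : Orthonormal ℂ (({j | l j ≠ 0} : Set ι).domRestrict v) := by
    rw [orthonormal_iff_ite]
    rintro ⟨i, hi⟩ ⟨j, hj⟩
    have h1 : inner ℂ (v i) (v j) =
        ((√(l i) : ℂ))⁻¹ * ((√(l j) : ℂ))⁻¹ * ∑ k, star (W k i) * W k j := by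
      rw [EuclideanSpace.inner_eq_star_dotProduct, dotProduct, Finset.mul_sum]
      refine Finset.sum_congr rfl fun k _ => ?_
      simp [v]
      ring
    simp only [Set.domRestrict_apply, Subtype.mk.injEq]
    rw [h1, hinner]
    by_cases hij : i = j
    · subst hij
      simp only [if_true]
      have h2 : ((√(l i) : ℝ) : ℂ) ≠ 0 := by
        exact_mod_cast (Real.sqrt_pos.2 (lt_of_le_of_ne (hl i) (Ne.symm hi))).ne'
      have h3 : ((l i : ℝ) : ℂ) = (√(l i) : ℂ) * √(l i) := by
        exact_mod_cast (Real.mul_self_sqrt (hl i)).symm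
      rw [h3]
      field_simp
    · simp [hij]
  obtain ⟨b, hb⟩ := hv.exists_orthonormalBasis_extension_of_card_eq (by simp)
  set U : Matrix ι ι ℂ := Matrix.of fun k j => b j k with hU
  refine ⟨U, ?_, V, hV, fun j => √(l j), fun j => Real.sqrt_nonneg _, ?_⟩
  · rw [Matrix.mem_unitaryGroup_iff']
    ext i j
    have h := (orthonormal_iff_ite.1 b.orthonormal) i j
    rw [EuclideanSpace.inner_eq_star_dotProduct, dotProduct] at h
    rw [Matrix.one_apply, ← h, Matrix.star_eq_conjTranspose, Matrix.mul_apply]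
    refine Finset.sum_congr rfl fun k _ => ?_
    simp [hU, mul_comm]
  · have hUW : U * Matrix.diagonal (fun j => (√(l j) : ℂ)) = W := by
      ext k j
      rw [Matrix.mul_diagonal]
      by_cases hj : l j = 0
      · have h0 := hinner j j
        simp only [if_true, hj, Complex.ofReal_zero] at h0
        have h1 : ∑ k, ‖W k j‖ ^ 2 = 0 := by
          have : ((∑ k, ‖W k j‖ ^ 2 : ℝ) : ℂ) = 0 := by
            rw [← h0]
            push_cast
            refine Finset.sum_congr rfl fun k _ => ?_
            rw [Complex.star_def, Complex.conj_mul']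
          exact_mod_cast this
        have h2 := (Finset.sum_eq_zero_iff_of_nonneg fun k _ => sq_nonneg _).1 h1 k
          (Finset.mem_univ k)
        have h3 : W k j = 0 := by simpa using h2
        simp [hj, h3]
      · have h2 : ((√(l j) : ℝ) : ℂ) ≠ 0 := by
          exact_mod_cast (Real.sqrt_pos.2 (lt_of_le_of_ne (hl j) (Ne.symm hj))).ne'
        simp only [hU, Matrix.of_apply, hb j hj, v]
        field_simp
    rw [hUW, Matrix.mul_assoc, hVV', Matrix.mul_one]

/-! ### Schur multipliers and unitarily invariant norms -/

/-- Every real-linear functional on complex matrices has the form `W ↦ Re tr (Z W)`. -/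
theorem exists_trace_representation {ι : Type*} [Fintype ι] [DecidableEq ι]
    (g : Matrix ι ι ℂ →ₗ[ℝ] ℝ) : ∃ Z : Matrix ι ι ℂ, ∀ W, g W = (Z * W).trace.re := by
  refine ⟨Matrix.of fun j i => (g (Matrix.single i j 1) : ℂ) -
    g (Matrix.single i j Complex.I) * Complex.I, fun W => ?_⟩
  conv_lhs => rw [Matrix.matrix_eq_sum_single W]
  rw [Matrix.trace, Finset.sum_comm]
  simp only [map_sum, Matrix.diag_apply, Matrix.mul_apply, Complex.re_sum, Matrix.of_apply]
  refine Finset.sum_congr rfl fun j _ => Finset.sum_congr rfl fun i _ => ?_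
  have h : Matrix.single i j (W i j) = (W i j).re • Matrix.single i j (1 : ℂ) +
      (W i j).im • Matrix.single i j Complex.I := by
    rw [Matrix.smul_single, Matrix.smul_single, ← Matrix.single_add]
    congr 1
    simp [Complex.re_add_im]
  rw [h, map_add, map_smul, map_smul]
  simp
  ring

/-- If `∑ₖ |d k i|² = M` for all `i`, then the squared moduli of the entries of the matrices
`U diag(d k) V`, with `U` and `V` unitary, sum to `M` along each row. -/
theorem sum_sum_norm_sq_row {ι κ : Type*} [Fintype ι] [DecidableEq ι] [Fintype κ]
    {U V : Matrix ι ι ℂ} (hU : U ∈ Matrix.unitaryGroup ι ℂ) (hV : V ∈ Matrix.unitaryGroup ι ℂ)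
    {d : κ → ι → ℂ} {M : ℝ} (hd : ∀ i, ∑ k, ‖d k i‖ ^ 2 = M) (i : ι) :
    ∑ j, ∑ k, ‖(U * Matrix.diagonal (d k) * V) i j‖ ^ 2 = M := by
  have hVV' : V * Vᴴ = 1 := Matrix.mem_unitaryGroup_iff.1 hV
  have hUU' : U * Uᴴ = 1 := Matrix.mem_unitaryGroup_iff.1 hU
  have h1 : ∀ k, ((∑ j, ‖(U * Matrix.diagonal (d k) * V) i j‖ ^ 2 : ℝ) : ℂ) =
      ∑ l, U i l * ((‖d k l‖ ^ 2 : ℝ) : ℂ) * Uᴴ l i := by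
    intro k
    have h : (U * Matrix.diagonal (d k) * V) * (U * Matrix.diagonal (d k) * V)ᴴ =
        U * Matrix.diagonal (fun l => ((‖d k l‖ ^ 2 : ℝ) : ℂ)) * Uᴴ := by
      rw [Matrix.conjTranspose_mul, Matrix.conjTranspose_mul, Matrix.diagonal_conjTranspose]
      simp only [Matrix.mul_assoc]
      rw [← Matrix.mul_assoc V, hVV', Matrix.one_mul, ← Matrix.mul_assoc (Matrix.diagonal _)
        (Matrix.diagonal _), Matrix.diagonal_mul_diagonal]
      congr 3
      ext l
      simp [Complex.mul_conj']
    have h2 := congr($h i i)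
    rw [Matrix.mul_apply, Matrix.mul_apply] at h2
    simp only [Matrix.mul_diagonal] at h2
    rw [← h2]
    push_cast
    refine Finset.sum_congr rfl fun j _ => ?_
    rw [Matrix.conjTranspose_apply, Complex.star_def, Complex.mul_conj']
  have h2 : ((∑ j, ∑ k, ‖(U * Matrix.diagonal (d k) * V) i j‖ ^ 2 : ℝ) : ℂ) = M := by
    rw [Finset.sum_comm, Complex.ofReal_sum]
    simp only [h1]
    rw [Finset.sum_comm]
    have h3 : ∀ l, ∑ k, U i l * ((‖d k l‖ ^ 2 : ℝ) : ℂ) * Uᴴ l i = M * (U i l * Uᴴ l i) := by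
      intro l
      rw [← Finset.sum_mul, ← Finset.mul_sum, ← Complex.ofReal_sum, hd l]
      ring
    simp only [h3]
    rw [← Finset.mul_sum, ← Matrix.mul_apply, hUU', Matrix.one_apply_eq, mul_one]
  exact_mod_cast h2

theorem sum_sum_norm_sq_col {ι κ : Type*} [Fintype ι] [DecidableEq ι] [Fintype κ]
    {U V : Matrix ι ι ℂ} (hU : U ∈ Matrix.unitaryGroup ι ℂ) (hV : V ∈ Matrix.unitaryGroup ι ℂ)
    {d : κ → ι → ℂ} {M : ℝ} (hd : ∀ i, ∑ k, ‖d k i‖ ^ 2 = M) (j : ι) :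
    ∑ i, ∑ k, ‖(U * Matrix.diagonal (d k) * V) i j‖ ^ 2 = M := by
  have h := sum_sum_norm_sq_row (Unitary.star_mem hV) (Unitary.star_mem hU)
    (d := fun k i => star (d k i)) (M := M) (by simpa using hd) j
  rw [← h]
  refine Finset.sum_congr rfl fun i _ => Finset.sum_congr rfl fun k _ => ?_
  have h2 : star V * Matrix.diagonal (fun i => star (d k i)) * star U =
      (U * Matrix.diagonal (d k) * V)ᴴ := by
    rw [Matrix.conjTranspose_mul, Matrix.conjTranspose_mul, Matrix.diagonal_conjTranspose,
      Matrix.mul_assoc]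
    rfl
  rw [h2, Matrix.conjTranspose_apply, norm_star]

/-- The norm depends only on the singular values, and not on their order. -/
theorem IsUnitarilyInvariantNorm.permute_singularValues {n : ℕ}
    {N : Seminorm ℂ (Matrix (Fin n) (Fin n) ℂ)} (hN : IsUnitarilyInvariantNorm N)
    {U V P Q : Matrix (Fin n) (Fin n) ℂ} (hU : U ∈ Matrix.unitaryGroup (Fin n) ℂ)
    (hV : V ∈ Matrix.unitaryGroup (Fin n) ℂ) (hP : P ∈ Matrix.unitaryGroup (Fin n) ℂ)
    (hQ : Q ∈ Matrix.unitaryGroup (Fin n) ℂ) (s : Fin n → ℝ) (σ : Equiv.Perm (Fin n)) :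
    N (Q * Matrix.diagonal (fun i => (s (σ i) : ℂ)) * Pᴴ) =
      N (U * Matrix.diagonal (fun i => (s i : ℂ)) * Vᴴ) := by
  have hR : σ.permMatrix ℂ ∈ Matrix.unitaryGroup (Fin n) ℂ := by
    rw [Matrix.mem_unitaryGroup_iff, Matrix.star_eq_conjTranspose, Matrix.conjTranspose_permMatrix,
      ← Matrix.permMatrix_mul, inv_mul_cancel, Matrix.permMatrix_one]
  have h : Matrix.diagonal (fun i => (s (σ i) : ℂ)) =
      σ.permMatrix ℂ * Matrix.diagonal (fun i => (s i : ℂ)) * (σ.permMatrix ℂ)ᴴ := by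
    ext i j
    rw [Matrix.mul_assoc, PEquiv.toMatrix_toPEquiv_mul, Matrix.submatrix_apply, Matrix.diagonal_mul,
      Matrix.conjTranspose_permMatrix, Matrix.diagonal_apply]
    simp [PEquiv.toMatrix_apply]
  have hR' : (σ.permMatrix ℂ)ᴴ ∈ Matrix.unitaryGroup (Fin n) ℂ := Unitary.star_mem hR
  have hP' : Pᴴ ∈ Matrix.unitaryGroup (Fin n) ℂ := Unitary.star_mem hP
  have hV' : Vᴴ ∈ Matrix.unitaryGroup (Fin n) ℂ := Unitary.star_mem hV
  rw [h, show Q * (σ.permMatrix ℂ * Matrix.diagonal (fun i => (s i : ℂ)) * (σ.permMatrix ℂ)ᴴ) * Pᴴ =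
    (Q * σ.permMatrix ℂ) * Matrix.diagonal (fun i => (s i : ℂ)) * ((σ.permMatrix ℂ)ᴴ * Pᴴ) by
      simp only [Matrix.mul_assoc],
    hN.unitary_invariant _ (mul_mem hQ hR) _ (mul_mem hR' hP'),
    hN.unitary_invariant _ hU _ hV']

/-- A real-linear norming functional of `y`, from the Hahn–Banach theorem. -/
theorem Seminorm.exists_real_dual {E : Type*} [AddCommGroup E] [Module ℂ E] (N : Seminorm ℂ E)
    (y : E) : ∃ g : E →ₗ[ℝ] ℝ, g y = N y ∧ ∀ x, g x ≤ N x := by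
  have hsmul : ∀ (c : ℝ) (x : E), N (c • x) = |c| * N x := fun c x => by
    rw [← Complex.coe_smul, map_smul_eq_mul, Complex.norm_real, Real.norm_eq_abs]
  have hH : ∀ c : ℝ, c • y = 0 → (RingHom.id ℝ) c • N y = 0 := fun c hc => by
    have := hsmul c y
    rw [hc, map_zero] at this
    rcases mul_eq_zero.1 this.symm with h | h
    · simp [abs_eq_zero.1 h]
    · simp [h]
  obtain ⟨g, hg1, hg2⟩ := exists_extension_of_le_sublinear
    (LinearPMap.mkSpanSingleton' y (N y) hH) N
    (fun c hc x => by rw [hsmul, abs_of_pos hc]) (fun x z => map_add_le_add N x z) (by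
      rintro ⟨x, hx⟩
      obtain ⟨c, rfl⟩ := Submodule.mem_span_singleton.1 hx
      rw [LinearPMap.mkSpanSingleton'_apply, hsmul]
      exact mul_le_mul_of_nonneg_right (le_abs_self c) (apply_nonneg N y))
  refine ⟨g, ?_, hg2⟩
  have hy : y ∈ (LinearPMap.mkSpanSingleton' y (N y) hH).domain :=
    Submodule.mem_span_singleton_self y
  rw [← LinearPMap.mkSpanSingleton'_apply_self y (N y) hH hy]
  exact hg1 ⟨y, hy⟩

open scoped MatrixOrder Matrix.Norms.L2Operator in
theorem Matrix.PosSemidef.exists_eq_conjTranspose_mul_self {ι : Type*} [Fintype ι] [DecidableEq ι]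
    {A : Matrix ι ι ℂ} (hA : A.PosSemidef) : ∃ C : Matrix ι ι ℂ, A = Cᴴ * C :=
  CStarAlgebra.nonneg_iff_eq_star_mul_self.1 hA.nonneg

/-- Let `Φ(Y) = ∑ₖ diag(d k) Y diag(e k)`, where the `k`-sums of the `|d k i|²` and of the
`|e k i|²` are all equal to `M > 0`. Then `|||Φ(Y)||| ≤ M |||Y|||`.

By the Hahn–Banach theorem it suffices to bound `Re tr (Z Φ(Y))` for those `Z` for which
`Re tr (Z W) ≤ |||W|||` for all `W`. Inserting singular value decompositions of `Y` and `Z` and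
using the arithmetic-geometric mean inequality, this is at most `∑ zᵢ sⱼ Sᵢⱼ`, where `z`, `s` are
the singular values and `S / M` is doubly stochastic. By Birkhoff's theorem the sum is `M` times an
average of sums `∑ zᵢ s_{σ(i)}`, each of which has the form `Re tr (Z W)` with `W` unitarily
equivalent to `Y`. -/
theorem IsUnitarilyInvariantNorm.apply_sum_diagonal_mul_mul_diagonal_le {n : ℕ}
    {N : Seminorm ℂ (Matrix (Fin n) (Fin n) ℂ)} (hN : IsUnitarilyInvariantNorm N)
    {κ : Type*} [Fintype κ] {d e : κ → Fin n → ℂ} {M : ℝ} (hM : 0 < M)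
    (hd : ∀ i, ∑ k, ‖d k i‖ ^ 2 = M) (he : ∀ i, ∑ k, ‖e k i‖ ^ 2 = M)
    (Y : Matrix (Fin n) (Fin n) ℂ) :
    N (∑ k, Matrix.diagonal (d k) * Y * Matrix.diagonal (e k)) ≤ M * N Y := by
  obtain ⟨g, hg1, hg2⟩ := N.exists_real_dual
    (∑ k, Matrix.diagonal (d k) * Y * Matrix.diagonal (e k))
  obtain ⟨Z, hZ⟩ := exists_trace_representation g
  obtain ⟨U, hU, V, hV, s, hs, hY⟩ := Y.exists_singularValueDecomposition
  obtain ⟨P, hP, Q, hQ, z, hz, hZPQ⟩ := Z.exists_singularValueDecomposition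
  have hV' : Vᴴ ∈ Matrix.unitaryGroup (Fin n) ℂ := Unitary.star_mem hV
  have hQ' : Qᴴ ∈ Matrix.unitaryGroup (Fin n) ℂ := Unitary.star_mem hQ
  set K : κ → Matrix (Fin n) (Fin n) ℂ := fun k => Qᴴ * Matrix.diagonal (d k) * U with hK
  set R : κ → Matrix (Fin n) (Fin n) ℂ := fun k => Vᴴ * Matrix.diagonal (e k) * P with hR
  set S : Matrix (Fin n) (Fin n) ℝ := Matrix.of fun i j =>
    (∑ k, ‖K k i j‖ ^ 2 + ∑ k, ‖R k j i‖ ^ 2) / 2 with hS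
  have hdouble : M⁻¹ • S ∈ doublyStochastic ℝ (Fin n) := by
    refine mem_doublyStochastic_iff_sum.2 ⟨fun i j => ?_, fun i => ?_, fun j => ?_⟩
    · simp only [hS, Matrix.smul_apply, Matrix.of_apply, smul_eq_mul]
      positivity
    · simp only [hS, Matrix.smul_apply, Matrix.of_apply, smul_eq_mul]
      rw [← Finset.mul_sum, ← Finset.sum_div, Finset.sum_add_distrib,
        sum_sum_norm_sq_row hQ' hU hd, sum_sum_norm_sq_col hV' hP he]
      field_simp
      norm_num
    · simp only [hS, Matrix.smul_apply, Matrix.of_apply, smul_eq_mul]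
      rw [← Finset.mul_sum, ← Finset.sum_div, Finset.sum_add_distrib,
        sum_sum_norm_sq_col hQ' hU hd, sum_sum_norm_sq_row hV' hP he]
      field_simp
      norm_num
  have htrace : ∀ k, (Z * (Matrix.diagonal (d k) * Y * Matrix.diagonal (e k))).trace =
      ∑ i, ∑ j, (z i : ℂ) * s j * (K k i j * R k j i) := by
    intro k
    have h1 : Z * (Matrix.diagonal (d k) * Y * Matrix.diagonal (e k)) =
        P * (Matrix.diagonal (fun i => (z i : ℂ)) * K k * Matrix.diagonal (fun i => (s i : ℂ)) *
          (Vᴴ * Matrix.diagonal (e k))) := by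
      rw [hY, hZPQ]
      simp only [hK, Matrix.mul_assoc]
    rw [h1, Matrix.trace_mul_comm, Matrix.mul_assoc _ _ P]
    change (_ * R k).trace = _
    rw [Matrix.trace]
    refine Finset.sum_congr rfl fun i _ => ?_
    rw [Matrix.diag_apply, Matrix.mul_apply]
    refine Finset.sum_congr rfl fun j _ => ?_
    rw [Matrix.mul_diagonal, Matrix.diagonal_mul]
    ring
  have hle : g (∑ k, Matrix.diagonal (d k) * Y * Matrix.diagonal (e k)) ≤
      ∑ i, ∑ j, z i * s j * S i j := by
    rw [map_sum]
    simp only [hZ, htrace, Complex.re_sum]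
    rw [Finset.sum_comm]
    refine Finset.sum_le_sum fun i _ => ?_
    rw [Finset.sum_comm]
    refine Finset.sum_le_sum fun j _ => ?_
    have h1 : ∀ k, ((z i : ℂ) * s j * (K k i j * R k j i)).re ≤
        z i * s j * ((‖K k i j‖ ^ 2 + ‖R k j i‖ ^ 2) / 2) := by
      intro k
      rw [← Complex.ofReal_mul, Complex.re_ofReal_mul]
      refine mul_le_mul_of_nonneg_left ?_ (mul_nonneg (hz i) (hs j))
      refine (Complex.re_le_norm _).trans ?_
      rw [norm_mul]
      nlinarith [sq_nonneg (‖K k i j‖ - ‖R k j i‖)]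
    refine (Finset.sum_le_sum fun k _ => h1 k).trans_eq ?_
    rw [← Finset.mul_sum, ← Finset.sum_div, Finset.sum_add_distrib]
    rfl
  obtain ⟨w, hw0, hw1, hw2⟩ := exists_eq_sum_perm_of_mem_doublyStochastic hdouble
  have hperm : ∀ σ : Equiv.Perm (Fin n), ∑ i, z i * s (σ i) ≤ N Y := by
    intro σ
    have h1 := hg2 (Q * Matrix.diagonal (fun i => (s (σ i) : ℂ)) * Pᴴ)
    rw [hN.permute_singularValues hU hV hP hQ, ← hY, hZ] at h1
    have h2 : Z * (Q * Matrix.diagonal (fun i => (s (σ i) : ℂ)) * Pᴴ) =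
        P * (Matrix.diagonal (fun i => ((z i * s (σ i) : ℝ) : ℂ)) * Pᴴ) := by
      have hQQ : Qᴴ * Q = 1 := Matrix.mem_unitaryGroup_iff'.1 hQ
      rw [hZPQ]
      simp only [Matrix.mul_assoc]
      rw [← Matrix.mul_assoc Qᴴ, hQQ, Matrix.one_mul, ← Matrix.mul_assoc (Matrix.diagonal _)
        (Matrix.diagonal _), Matrix.diagonal_mul_diagonal]
      simp
    have hPP : Pᴴ * P = 1 := Matrix.mem_unitaryGroup_iff'.1 hP
    rw [h2, Matrix.trace_mul_comm, Matrix.mul_assoc, hPP, Matrix.mul_one, Matrix.trace_diagonal,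
      ← Complex.ofReal_sum, Complex.ofReal_re] at h1
    exact h1
  have hsum : ∑ i, ∑ j, z i * s j * S i j = M * ∑ σ, w σ * ∑ i, z i * s (σ i) := by
    have h1 : ∀ i j, S i j = M * ∑ σ, w σ * (σ.permMatrix ℝ) i j := by
      intro i j
      have h := congr($hw2 i j)
      rw [Matrix.sum_apply] at h
      simp only [Matrix.smul_apply, smul_eq_mul] at h
      rw [h, mul_inv_cancel_left₀ hM.ne']
    have h2 : ∀ i, ∑ j, z i * s j * S i j = ∑ σ, M * (w σ * (z i * s (σ i))) := by
      intro i
      simp only [h1, Finset.mul_sum]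
      rw [Finset.sum_comm]
      refine Finset.sum_congr rfl fun σ _ => ?_
      rw [Finset.sum_eq_single (σ i)]
      · simp [PEquiv.toMatrix_apply]
        ring
      · intro j _ hj
        simp [PEquiv.toMatrix_apply, hj.symm]
      · simp
    simp only [h2]
    rw [Finset.sum_comm]
    simp only [Finset.mul_sum]
  rw [← hg1]
  refine hle.trans ?_
  rw [hsum]
  refine mul_le_mul_of_nonneg_left ?_ hM.le
  calc ∑ σ, w σ * ∑ i, z i * s (σ i) ≤ ∑ σ, w σ * N Y :=
        Finset.sum_le_sum fun σ _ => mul_le_mul_of_nonneg_left (hperm σ) (hw0 σ)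
    _ = N Y := by rw [← Finset.sum_mul, hw1, one_mul]

/-- Schur multiplication by an off-diagonal block of a positive semidefinite matrix with diagonal
at most `M` increases a unitarily invariant norm at most by the factor `M`. -/
theorem IsUnitarilyInvariantNorm.apply_schur_le {n : ℕ}
    {N : Seminorm ℂ (Matrix (Fin n) (Fin n) ℂ)} (hN : IsUnitarilyInvariantNorm N)
    {L : Matrix (Fin n ⊕ Fin n) (Fin n ⊕ Fin n) ℂ} (hL : L.PosSemidef) {M : ℝ} (hM : 0 ≤ M)
    (hdiag : ∀ k, (L k k).re ≤ M) (Y : Matrix (Fin n) (Fin n) ℂ) :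
    N (Matrix.of fun i j => L (Sum.inl i) (Sum.inr j) * Y i j) ≤ M * N Y := by
  rcases hM.eq_or_lt with rfl | hM
  · have h0 : ∀ k l, L k l = 0 := fun k l => by
      have h := norm_sq_apply_le_of_posSemidef hL k l
      have hk := (Complex.nonneg_iff.1 (hL.diag_nonneg (i := k))).1
      have hk0 : (L k k).re = 0 := le_antisymm (hdiag k) hk
      rw [hk0, zero_mul] at h
      exact norm_eq_zero.1 (pow_eq_zero_iff two_ne_zero |>.1 (le_antisymm h (sq_nonneg _)))
    have h1 : (Matrix.of fun i j => L (Sum.inl i) (Sum.inr j) * Y i j) = 0 := by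
      ext i j
      simp [h0]
    rw [h1, map_zero, zero_mul]
  -- Raising the diagonal to `M` does not affect the off-diagonal block.
  have hpad : (L + Matrix.diagonal fun k => ((M - (L k k).re : ℝ) : ℂ)).PosSemidef := by
    refine hL.add (Matrix.PosSemidef.diagonal fun k => ?_)
    simp only [Pi.zero_apply]
    exact_mod_cast sub_nonneg.2 (hdiag k)
  obtain ⟨C, hC⟩ := hpad.exists_eq_conjTranspose_mul_self
  have hnorm : ∀ l, ∑ k, ‖C k l‖ ^ 2 = M := by
    intro l
    have h := congr(($hC l l).re)
    rw [Matrix.mul_apply] at h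
    simp only [Matrix.add_apply, Matrix.diagonal_apply_eq, Complex.add_re, Complex.ofReal_re,
      Complex.re_sum, Matrix.conjTranspose_apply, Complex.star_def, Complex.conj_mul'] at h
    norm_cast at h
    linarith
  have h := hN.apply_sum_diagonal_mul_mul_diagonal_le (d := fun k i => star (C k (Sum.inl i)))
    (e := fun k j => C k (Sum.inr j)) hM (fun i => by simpa using hnorm (Sum.inl i))
    (fun j => hnorm (Sum.inr j)) Y
  convert h using 2
  ext i j
  have hij := congr($hC (Sum.inl i) (Sum.inr j))
  rw [Matrix.mul_apply, Matrix.add_apply, Matrix.diagonal_apply_ne _ Sum.inl_ne_inr, add_zero] at hij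
  rw [Matrix.of_apply, hij, Matrix.sum_apply, Finset.sum_mul]
  refine Finset.sum_congr rfl fun k _ => ?_
  rw [Matrix.mul_diagonal, Matrix.diagonal_mul, Matrix.conjTranspose_apply]
  ring

/-! ### The norm inequality -/

open scoped Matrix.Norms.L2Operator in
theorem abs_apply_eigenvalue_le_matrixOpNorm_cfc {n : ℕ} {A : Matrix (Fin n) (Fin n) ℂ}
    (hA : A.IsHermitian) (g : ℝ → ℝ) (i : Fin n) :
    |g (hA.eigenvalues i)| ≤ matrixOpNorm (cfc g A) := by
  have hfin : ContinuousOn g (spectrum ℝ A) := by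
    have := Matrix.finite_real_spectrum (A := A)
    exact this.continuousOn g
  exact norm_apply_le_norm_cfc g A (hA.eigenvalues_mem_spectrum_real i) hfin hA

theorem theoremt1 {n : ℕ} (A B X : Matrix (Fin n) (Fin n) ℂ) (hA : A.PosDef) (hB : B.PosDef)
    (f : ℝ → ℝ) (hf : OperatorMonotoneOnPos f) :
    DifferentiableOn ℝ f (Set.Ioi 0) ∧
      ∀ N : Seminorm ℂ (Matrix (Fin n) (Fin n) ℂ), IsUnitarilyInvariantNorm N →
        N (cfc f A * X - X * cfc f B) ≤
          max (matrixOpNorm (cfc (deriv f) A)) (matrixOpNorm (cfc (deriv f) B)) *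
            N (A * X - X * B) := by
  refine ⟨fun t ht => (hf.hasDerivAt ht).differentiableAt.differentiableWithinAt, fun N hN => ?_⟩
  obtain ⟨U, hU, hAU, hfA⟩ := hA.1.exists_diagonalization
  obtain ⟨V, hV, hBV, hfB⟩ := hB.1.exists_diagonalization
  have ha := hA.eigenvalues_pos
  have hb := hB.eigenvalues_pos
  have hMa := abs_apply_eigenvalue_le_matrixOpNorm_cfc hA.1 (deriv f)
  have hMb := abs_apply_eigenvalue_le_matrixOpNorm_cfc hB.1 (deriv f)
  specialize hfA f
  specialize hfB f
  generalize hA.1.eigenvalues = a at *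
  generalize hB.1.eigenvalues = b at *
  set M := max (matrixOpNorm (cfc (deriv f) A)) (matrixOpNorm (cfc (deriv f) B))
  have hM : 0 ≤ M := le_max_of_le_left (norm_nonneg _)
  have hL : (loewnerMatrix f (deriv f) (Sum.elim a b)).PosSemidef := by
    refine hf.posSemidef_loewnerMatrix (fun k => ?_) fun t ht =>
      (hf.hasDerivAt ht).differentiableAt.hasDerivAt.hasDerivWithinAt
    cases k
    · exact ha _
    · exact hb _
  have hdiag : ∀ k, (loewnerMatrix f (deriv f) (Sum.elim a b) k k).re ≤ M := by
    intro k
    rw [loewnerMatrix_apply_self, Complex.ofReal_re]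
    cases k with
    | inl i => exact (le_abs_self _).trans ((hMa i).trans (le_max_left _ _))
    | inr j => exact (le_abs_self _).trans ((hMb j).trans (le_max_right _ _))
  have hU' : Uᴴ ∈ Matrix.unitaryGroup (Fin n) ℂ := Unitary.star_mem hU
  have hUU : Uᴴ * U = 1 := Matrix.mem_unitaryGroup_iff'.1 hU
  have hVV : Vᴴ * V = 1 := Matrix.mem_unitaryGroup_iff'.1 hV
  have hconj : ∀ c e : Fin n → ℂ, Uᴴ * (U * Matrix.diagonal c * Uᴴ * X -
      X * (V * Matrix.diagonal e * Vᴴ)) * V =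
      Matrix.of fun i j => (c i - e j) * (Uᴴ * X * V) i j := by
    intro c e
    have h1 : Uᴴ * (U * Matrix.diagonal c * Uᴴ * X - X * (V * Matrix.diagonal e * Vᴴ)) * V =
        Matrix.diagonal c * (Uᴴ * X * V) - (Uᴴ * X * V) * Matrix.diagonal e := by
      rw [Matrix.mul_sub, Matrix.sub_mul]
      simp only [Matrix.mul_assoc, hVV, Matrix.mul_one]
      rw [← Matrix.mul_assoc Uᴴ U, hUU, Matrix.one_mul]
    rw [h1]
    ext i j
    rw [Matrix.sub_apply, Matrix.diagonal_mul, Matrix.mul_diagonal, Matrix.of_apply]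
    ring
  have hschur : Uᴴ * (cfc f A * X - X * cfc f B) * V = Matrix.of fun i j =>
      loewnerMatrix f (deriv f) (Sum.elim a b) (Sum.inl i) (Sum.inr j) *
        (Uᴴ * (A * X - X * B) * V) i j := by
    rw [hfA, hfB, hconj]
    conv_rhs => rw [hAU, hBV]
    rw [hconj]
    ext i j
    simp only [Matrix.of_apply]
    by_cases hij : a i = b j
    · simp [hij]
    · rw [loewnerMatrix_apply_of_ne _ _ (by simpa using hij), slope_def_field]
      have h1 : ((b j : ℂ) - a i) ≠ 0 := sub_ne_zero.2 (by exact_mod_cast Ne.symm hij)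
      simp only [Sum.elim_inl, Sum.elim_inr]
      push_cast
      field_simp
      ring
  calc N (cfc f A * X - X * cfc f B) = N (Uᴴ * (cfc f A * X - X * cfc f B) * V) :=
        (hN.unitary_invariant _ hU' _ hV _).symm
    _ ≤ M * N (Uᴴ * (A * X - X * B) * V) := by
        rw [hschur]
        exact hN.apply_schur_le hL hM hdiag _
    _ = M * N (A * X - X * B) := by rw [hN.unitary_invariant _ hU' _ hV]
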